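/- For every positive integer $n$ let $(c_n(i,j))_{1\le i,j\le n}$ be a random matrix of independent standard Gaussian random variables. Let $S_n$ be the group of permutations of $\{1,\dots,n\}$, let \[ g_{n,u} = \frac{1}{\sqrt n}\sum_{i=1}^n c_n(i,u(i)), \qquad u\in S_n, \] be the Gaussian random assignment field, and let $M_n=\max_{u\in S_n} g_{n,u}$ be its maximum. Then $M_n$ is square integrable and \[ \lim_{n\to\infty}\operatorname{Var}(M_n)=0. \] In particular, the maximum of the Gaussian random assignment field is superconcentrated: the variance of the maximum is of smaller order than the largest variance of an individual variable, i.e., $\operatorname{Var}(M_n)=o\bigl(\max_{u\in S_n}\operatorname{Var}(g_{n,u})\bigr)$ as $n\to\infty$. -/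

import Mathlib

open MeasureTheory ProbabilityTheory Filter Topology Asymptotics

/-- The Gaussian random assignment field built from a random cost matrix `c`:
`g u = n ^ (-1/2) * ∑ i, c (i, u i)`, indexed by the permutations `u` of `n` objects. -/
noncomputable def assignmentField {Ω : Type*} {n : ℕ} (c : Fin n → Fin n → Ω → ℝ)
    (u : Equiv.Perm (Fin n)) (ω : Ω) : ℝ :=
  (1 / Real.sqrt (n : ℝ)) * ∑ i : Fin n, c i (u i) ω

/-- The maximum of a random field over its finite non-empty index set. -/
noncomputable def fieldMax {Ω ι : Type*} [Fintype ι] [Nonempty ι] (g : ι → Ω → ℝ) (ω : Ω) : ℝ :=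
  Finset.univ.sup' Finset.univ_nonempty (fun u => g u ω)

/-- The largest variance of the individual variables of a finite random field. -/
noncomputable def fieldMaxVariance {Ω ι : Type*} [MeasurableSpace Ω] [Fintype ι] [Nonempty ι]
    (μ : Measure Ω) (g : ι → Ω → ℝ) : ℝ :=
  Finset.univ.sup' Finset.univ_nonempty (fun u => Var[g u; μ])

/-- The maxima of a sequence of finite (centred Gaussian) fields are superconcentrated: the
variance of the maximum is of smaller order than the largest variance of an individual variable. -/
def IsSuperconcentrated {Ω : ℕ → Type*} [∀ n, MeasurableSpace (Ω n)] {ι : ℕ → Type*}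
    [∀ n, Fintype (ι n)] [∀ n, Nonempty (ι n)] (μ : ∀ n, Measure (Ω n))
    (g : ∀ n, ι n → Ω n → ℝ) : Prop :=
  (fun n => Var[fieldMax (g n); μ n]) =o[atTop] (fun n => fieldMaxVariance (μ n) (g n))

/-! A Poincaré bound only gives that the variance is bounded: each of the `n ^ 2` entries moves the
maximum at rate at most `1 / √n`, and only when the optimal assignment uses it, which has
probability about `1 / n`. The gain comes from Talagrand's observation that derivatives supported on
rare events carry little low-degree Fourier mass, by hypercontractivity.

This is carried out on the discrete cube, each Gaussian entry being replaced by a normalized sum of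
`m` signs. Discrete derivatives of the maximum are at most `1 / √(n m)` (`abs_flipDiff_signMax_le`).
They are nonzero with probability at most `2 / n`: column permutations preserve the law, while an
optimal assignment uses one entry per row (`expect_posPivotal_le`). Bonami's inequality controls the
Fourier levels up to `K` and total influence those above (`expect_sq_sub_sq_expect_le`), giving the
bound `2 ^ (K + 1) * √√(2 / n) + 2 / K`. It does not depend on `m`, so it survives the central limit
theorem (`variance_pi_gaussianReal_le`). Fixing `K` large and then letting `n` grow finishes the
proof. -/

open scoped BigOperators

/-- The sign `±1` encoded by a Boolean. -/
def bsign (b : Bool) : ℝ := if b then 1 else -1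

lemma bsign_not (b : Bool) : bsign (!b) = -bsign b := by
  cases b <;> simp [bsign]

lemma bsign_mul_self (b : Bool) : bsign b * bsign b = 1 := by
  cases b <;> simp [bsign]

/-! ### Fourier analysis and hypercontractivity on the discrete cube. -/

section Cube

variable {κ : Type*}

/-- Walsh characters of the cube. -/
def walsh (S : Finset κ) (x : κ → Bool) : ℝ := ∏ i ∈ S, bsign (x i)

/-- The sum expands the product of the factors `1 + bsign (x i) * bsign (y i)`, and a coordinate
where `x` and `y` differ gives a zero factor. -/
lemma sum_walsh_mul_walsh [Fintype κ] (x y : κ → Bool) :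
    ∑ S : Finset κ, walsh S x * walsh S y = if x = y then (2 : ℝ) ^ Fintype.card κ else 0 := by
  have h : ∑ S : Finset κ, walsh S x * walsh S y = ∏ i, (1 + bsign (x i) * bsign (y i)) := by
    rw [Finset.prod_one_add, Finset.powerset_univ]
    exact Finset.sum_congr rfl fun S _ => by rw [walsh, walsh, Finset.prod_mul_distrib]
  rw [h]
  split_ifs with hxy
  · subst hxy
    rw [Finset.prod_congr rfl (g := fun _ => (2 : ℝ)) fun i _ => by rw [bsign_mul_self]; norm_num]
    simp
  · obtain ⟨i, hi⟩ := Function.ne_iff.1 hxy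
    refine Finset.prod_eq_zero (Finset.mem_univ i) ?_
    revert hi
    cases x i <;> cases y i <;> simp [bsign]

variable [DecidableEq κ]

/-- Negation of one coordinate of a point of the cube. -/
def flipAt (k : κ) (x : κ → Bool) : κ → Bool := Function.update x k (!x k)

lemma flipAt_self (k : κ) (x : κ → Bool) : flipAt k x k = !x k := by
  simp [flipAt]

lemma flipAt_of_ne {k i : κ} (h : i ≠ k) (x : κ → Bool) : flipAt k x i = x i := by
  simp [flipAt, h]

lemma flipAt_involutive (k : κ) : Function.Involutive (flipAt k) := by
  intro x
  ext i
  by_cases h : i = k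
  · subst h; simp [flipAt_self]
  · simp [flipAt_of_ne h]

lemma walsh_flipAt_of_notMem {k : κ} {S : Finset κ} (h : k ∉ S) (x : κ → Bool) :
    walsh S (flipAt k x) = walsh S x :=
  Finset.prod_congr rfl fun i hi => by
    rw [flipAt_of_ne (ne_of_mem_of_not_mem hi h)]

lemma walsh_insert {k : κ} {S : Finset κ} (h : k ∉ S) (x : κ → Bool) :
    walsh (insert k S) x = bsign (x k) * walsh S x :=
  Finset.prod_insert h

lemma walsh_flipAt_of_mem {k : κ} {S : Finset κ} (h : k ∈ S) (x : κ → Bool) :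
    walsh S (flipAt k x) = -walsh S x := by
  rw [← Finset.insert_erase h, walsh_insert (Finset.notMem_erase k S),
    walsh_insert (Finset.notMem_erase k S), flipAt_self, bsign_not,
    walsh_flipAt_of_notMem (Finset.notMem_erase k S), neg_mul]

/-- The antisymmetric part of `f` in the `k`-th coordinate. -/
noncomputable def flipDiff (k : κ) (f : (κ → Bool) → ℝ) (x : κ → Bool) : ℝ :=
  (f x - f (flipAt k x)) / 2

variable [Fintype κ]

lemma expect_flipAt (k : κ) (f : (κ → Bool) → ℝ) : 𝔼 x, f (flipAt k x) = 𝔼 x, f x :=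
  Fintype.expect_equiv (flipAt_involutive k).toPerm _ _ fun _ => rfl

/-- Fourier–Walsh coefficients. -/
noncomputable def walshCoeff (f : (κ → Bool) → ℝ) (S : Finset κ) : ℝ := 𝔼 x, f x * walsh S x

lemma walshCoeff_empty (f : (κ → Bool) → ℝ) : walshCoeff f ∅ = 𝔼 x, f x := by
  simp [walshCoeff, walsh]

/-- Parseval's identity on the cube. -/
lemma sum_walshCoeff_sq (f : (κ → Bool) → ℝ) :
    ∑ S : Finset κ, walshCoeff f S ^ 2 = 𝔼 x, f x ^ 2 := by
  have h : ∀ S : Finset κ, walshCoeff f S ^ 2 =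
      𝔼 x, 𝔼 y, f x * f y * (walsh S x * walsh S y) := by
    intro S
    rw [sq, walshCoeff, Finset.expect_mul_expect]
    refine Finset.expect_congr rfl fun x _ => Finset.expect_congr rfl fun y _ => by ring
  simp_rw [h]
  rw [← Finset.expect_sum_comm]
  refine Finset.expect_congr rfl fun x _ => ?_
  rw [← Finset.expect_sum_comm]
  simp_rw [← Finset.mul_sum, sum_walsh_mul_walsh]
  rw [Fintype.expect_eq_sum_div_card]
  simp only [mul_ite, mul_zero, Finset.sum_ite_eq, Finset.mem_univ, if_true]
  simp
  ring

lemma walshCoeff_flipDiff (k : κ) (f : (κ → Bool) → ℝ) (S : Finset κ) :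
    walshCoeff (flipDiff k f) S = if k ∈ S then walshCoeff f S else 0 := by
  have h : walshCoeff (flipDiff k f) S =
      (𝔼 x, f x * walsh S x - 𝔼 x, f x * walsh S (flipAt k x)) / 2 := by
    rw [← expect_flipAt k (fun x => f x * walsh S (flipAt k x)), ← Finset.expect_sub_distrib,
      Finset.expect_div]
    refine Finset.expect_congr rfl fun x _ => ?_
    rw [flipAt_involutive k x, flipDiff]
    ring
  rw [h]
  split_ifs with hk
  · simp_rw [walsh_flipAt_of_mem hk, mul_neg, Finset.expect_neg_distrib]
    rw [walshCoeff]; ring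
  · simp_rw [walsh_flipAt_of_notMem hk]
    simp

/-- Each `S` is counted once for every `k ∈ S`. The weight `1` gives the total influence, the weight
`(1 / 2) ^ S.card` its noisy version. -/
lemma sum_walshCoeff_flipDiff_sq (w : Finset κ → ℝ) (f : (κ → Bool) → ℝ) :
    ∑ k, ∑ S : Finset κ, w S * walshCoeff (flipDiff k f) S ^ 2 =
      ∑ S : Finset κ, S.card * (w S * walshCoeff f S ^ 2) := by
  rw [Finset.sum_comm]
  refine Finset.sum_congr rfl fun S _ => ?_
  have : ∀ k, w S * walshCoeff (flipDiff k f) S ^ 2 =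
      if k ∈ S then w S * walshCoeff f S ^ 2 else 0 := by
    intro k
    rw [walshCoeff_flipDiff]
    split_ifs <;> simp
  simp_rw [this]
  simp

lemma expect_mul_bsign_eq_zero {k : κ} {g : (κ → Bool) → ℝ} (hg : ∀ x, g (flipAt k x) = g x) :
    𝔼 x, bsign (x k) * g x = 0 := by
  have h := expect_flipAt k fun x => bsign (x k) * g x
  simp_rw [hg, flipAt_self, bsign_not, neg_mul, Finset.expect_neg_distrib] at h
  linarith

/-- **Bonami's inequality**: the noise operator with parameter `1 / 2` maps `L²` to `L⁴`
contractively. -/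
lemma expect_noise_pow_four_le (A : Finset κ) (a : Finset κ → ℝ) :
    𝔼 x, (∑ S ∈ A.powerset, (1 / 2 : ℝ) ^ S.card * a S * walsh S x) ^ 4 ≤
      (∑ S ∈ A.powerset, a S ^ 2) ^ 2 := by
  induction A using Finset.induction_on generalizing a with
  | empty => simp [walsh, ← pow_mul]
  | insert k A hk ih =>
    have hS : ∀ S ∈ A.powerset, k ∉ S := fun S hS h => hk (Finset.mem_powerset.1 hS h)
    set u : (κ → Bool) → ℝ := fun x => ∑ S ∈ A.powerset, (1 / 2 : ℝ) ^ S.card * a S * walsh S x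
      with hu
    set v : (κ → Bool) → ℝ := fun x =>
      ∑ S ∈ A.powerset, (1 / 2 : ℝ) ^ S.card * a (insert k S) * walsh S x with hv
    have hsplit : ∀ x, ∑ S ∈ (insert k A).powerset, (1 / 2 : ℝ) ^ S.card * a S * walsh S x =
        u x + bsign (x k) * ((1 / 2) * v x) := by
      intro x
      rw [Finset.sum_powerset_insert hk, hu, hv]
      simp only [Finset.mul_sum]
      congr 1
      refine Finset.sum_congr rfl fun S h => ?_
      rw [walsh_insert (hS S h), Finset.card_insert_of_notMem (hS S h)]
      ring
    have hinv : ∀ (b : Finset κ → ℝ) (x : κ → Bool),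
        ∑ S ∈ A.powerset, (1 / 2 : ℝ) ^ S.card * b S * walsh S (flipAt k x) =
          ∑ S ∈ A.powerset, (1 / 2 : ℝ) ^ S.card * b S * walsh S x := fun b x =>
      Finset.sum_congr rfl fun S h => by rw [walsh_flipAt_of_notMem (hS S h)]
    have hui : ∀ x, u (flipAt k x) = u x := hinv a
    have hvi : ∀ x, v (flipAt k x) = v x := hinv fun S => a (insert k S)
    -- The terms odd in the new sign are grouped together: `u` and `v` do not depend on coordinate
    -- `k`, so these terms average to zero.
    have hexp : ∀ x, (u x + bsign (x k) * ((1 / 2) * v x)) ^ 4 =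
        u x ^ 4 + (3 / 2) * (u x ^ 2 * v x ^ 2) + (1 / 16) * v x ^ 4 +
          bsign (x k) * (2 * u x ^ 3 * v x + (1 / 2) * u x * v x ^ 3) := by
      intro x
      have h2 := bsign_mul_self (x k)
      linear_combination ((3 / 2) * u x ^ 2 * v x ^ 2 + (1 / 2) * u x * v x ^ 3 * bsign (x k) +
        (1 / 16) * v x ^ 4 * (bsign (x k) * bsign (x k) + 1)) * h2
    rw [Finset.sum_powerset_insert hk]
    simp_rw [hsplit, hexp, Finset.expect_add_distrib, ← Finset.mul_expect]
    rw [expect_mul_bsign_eq_zero (fun x => by rw [hui, hvi]), add_zero]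
    have h1 := ih a
    have h2 := ih fun S => a (insert k S)
    have hcs := Finset.expect_mul_sq_le_sq_mul_sq Finset.univ (fun x => u x ^ 2) fun x => v x ^ 2
    simp_rw [← pow_mul] at hcs
    norm_num at hcs
    change 𝔼 x, u x ^ 4 ≤ _ at h1
    change 𝔼 x, v x ^ 4 ≤ _ at h2
    set P := ∑ S ∈ A.powerset, a S ^ 2 with hP
    set Q := ∑ S ∈ A.powerset, a (insert k S) ^ 2 with hQ
    have hP0 : 0 ≤ P := Finset.sum_nonneg fun _ _ => sq_nonneg _
    have hQ0 : 0 ≤ Q := Finset.sum_nonneg fun _ _ => sq_nonneg _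
    have hv4 : 0 ≤ 𝔼 x, v x ^ 4 := Finset.expect_nonneg fun _ _ => by positivity
    have hm : 𝔼 x, u x ^ 2 * v x ^ 2 ≤ P * Q := by
      refine abs_le_of_sq_le_sq' ?_ (by positivity) |>.2
      calc _ ≤ _ := hcs
        _ ≤ P ^ 2 * Q ^ 2 := by gcongr
        _ = _ := by ring
    -- The cross coefficient is `6 * (1 / 2) ^ 2 = 3 / 2`, below the `2` in `(P + Q) ^ 2`.
    nlinarith [mul_nonneg hP0 hQ0, sq_nonneg Q]

/-- The noise stability at correlation `1 / 2` of a bounded function with small support. -/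
lemma sum_half_pow_mul_walshCoeff_sq_le {h : (κ → Bool) → ℝ} {s q : ℝ} (hq : 0 ≤ q)
    (hb : ∀ x, |h x| ≤ s) (hp : (𝔼 x, if h x = 0 then (0 : ℝ) else 1) ≤ q ^ 4) :
    ∑ S : Finset κ, (1 / 2 : ℝ) ^ S.card * walshCoeff h S ^ 2 ≤ s ^ 2 * q ^ 5 := by
  set T : (κ → Bool) → ℝ := fun x =>
    ∑ S : Finset κ, (1 / 2 : ℝ) ^ S.card * walshCoeff h S * walsh S x with hT
  set B : (κ → Bool) → ℝ := fun x => if h x = 0 then (0 : ℝ) else 1 with hB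
  have hBB : ∀ x, B x ^ 2 = B x := by intro x; simp only [hB]; split_ifs <;> simp
  have hB0 : ∀ x, 0 ≤ B x := by intro x; simp only [hB]; split_ifs <;> simp
  have hsq : ∀ x, h x ^ 2 ≤ s ^ 2 * B x := by
    intro x
    by_cases h0 : h x = 0
    · simp [hB, h0]
    · simpa [hB, h0] using sq_le_sq' (abs_le.1 (hb x)).1 (abs_le.1 (hb x)).2
  have hL2 : 𝔼 x, h x ^ 2 ≤ s ^ 2 * q ^ 4 := by
    calc 𝔼 x, h x ^ 2 ≤ 𝔼 x, s ^ 2 * B x := Finset.expect_le_expect fun x _ => hsq x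
      _ = s ^ 2 * 𝔼 x, B x := (Finset.mul_expect ..).symm
      _ ≤ _ := by gcongr
  have hL20 : 0 ≤ 𝔼 x, h x ^ 2 := Finset.expect_nonneg fun _ _ => sq_nonneg _
  have hT4 : 𝔼 x, T x ^ 4 ≤ (s ^ 2 * q ^ 4) ^ 2 := by
    have := expect_noise_pow_four_le Finset.univ (walshCoeff h)
    rw [Finset.powerset_univ, sum_walshCoeff_sq] at this
    exact this.trans (by gcongr)
  have hinner : ∑ S : Finset κ, (1 / 2 : ℝ) ^ S.card * walshCoeff h S ^ 2 = 𝔼 x, h x * T x := by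
    simp_rw [hT, Finset.mul_sum, Finset.expect_sum_comm]
    refine Finset.sum_congr rfl fun S _ => ?_
    have : 𝔼 x, h x * ((1 / 2 : ℝ) ^ S.card * walshCoeff h S * walsh S x) =
        𝔼 x, (1 / 2 : ℝ) ^ S.card * walshCoeff h S * (h x * walsh S x) :=
      Finset.expect_congr rfl fun x _ => by ring
    rw [this, ← Finset.mul_expect, ← walshCoeff]
    ring
  rw [hinner]
  -- As `h = h * B`, Cauchy–Schwarz can be applied with `B` inserted, and again to `B * T ^ 2`.
  -- Bonami's bound on the fourth moment of `T` then gains a factor `q` over the trivial `s ^ 2 * q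
  -- ^ 4`.
  have e1 : (𝔼 x, h x * T x) ^ 2 ≤ (s ^ 2 * q ^ 4) * 𝔼 x, B x * T x ^ 2 := by
    have := Finset.expect_mul_sq_le_sq_mul_sq Finset.univ h fun x => B x * T x
    have hBT : ∀ x, h x * (B x * T x) = h x * T x := by
      intro x
      by_cases h0 : h x = 0 <;> simp [hB, h0]
    simp_rw [hBT, mul_pow, hBB] at this
    refine this.trans ?_
    gcongr
  have e2 : (𝔼 x, B x * T x ^ 2) ^ 2 ≤ q ^ 4 * (s ^ 2 * q ^ 4) ^ 2 := by
    have := Finset.expect_mul_sq_le_sq_mul_sq Finset.univ B fun x => T x ^ 2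
    simp_rw [hBB, ← pow_mul] at this
    norm_num at this
    refine this.trans ?_
    gcongr
  have e2' : 𝔼 x, B x * T x ^ 2 ≤ q ^ 2 * (s ^ 2 * q ^ 4) :=
    abs_le_of_sq_le_sq' (e2.trans_eq (by ring)) (by positivity) |>.2
  refine abs_le_of_sq_le_sq' ?_ (by positivity) |>.2
  calc _ ≤ _ := e1
    _ ≤ (s ^ 2 * q ^ 4) * (q ^ 2 * (s ^ 2 * q ^ 4)) := by gcongr
    _ = _ := by ring

/-- A variance bound of Talagrand type on the cube: functions all of whose discrete derivatives
are small and rarely nonzero have a variance much smaller than the Poincaré bound. -/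
lemma expect_sq_sub_sq_expect_le {f : (κ → Bool) → ℝ} {s q : ℝ} (hq : 0 ≤ q)
    (hb : ∀ k x, |flipDiff k f x| ≤ s)
    (hp : ∀ k, (𝔼 x, if flipDiff k f x = 0 then (0 : ℝ) else 1) ≤ q ^ 4) {K : ℕ} (hK : 0 < K) :
    𝔼 x, f x ^ 2 - (𝔼 x, f x) ^ 2 ≤
      Fintype.card κ * s ^ 2 * (2 ^ K * q ^ 5 + q ^ 4 / K) := by
  have hKR : (0 : ℝ) < K := by exact_mod_cast hK
  have h1 : ∑ S : Finset κ, S.card * ((1 / 2 : ℝ) ^ S.card * walshCoeff f S ^ 2) ≤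
      Fintype.card κ * (s ^ 2 * q ^ 5) := by
    rw [← sum_walshCoeff_flipDiff_sq]
    refine (Finset.sum_le_sum fun k _ =>
      sum_half_pow_mul_walshCoeff_sq_le hq (hb k) (hp k)).trans_eq ?_
    simp
  have h2 : ∑ S : Finset κ, S.card * (1 * walshCoeff f S ^ 2) ≤
      Fintype.card κ * (s ^ 2 * q ^ 4) := by
    rw [← sum_walshCoeff_flipDiff_sq (fun _ => 1)]
    simp_rw [one_mul, sum_walshCoeff_sq]
    refine (Finset.sum_le_sum (g := fun _ => s ^ 2 * q ^ 4) fun k _ => ?_).trans_eq (by simp)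
    calc 𝔼 x, flipDiff k f x ^ 2
        ≤ 𝔼 x, s ^ 2 * (if flipDiff k f x = 0 then (0 : ℝ) else 1) := by
          refine Finset.expect_le_expect fun x _ => ?_
          split_ifs with h0
          · simp [h0]
          · simpa using sq_le_sq' (abs_le.1 (hb k x)).1 (abs_le.1 (hb k x)).2
      _ = s ^ 2 * 𝔼 x, (if flipDiff k f x = 0 then (0 : ℝ) else 1) := (Finset.mul_expect ..).symm
      _ ≤ _ := by gcongr; exact hp k
  have hvar : 𝔼 x, f x ^ 2 - (𝔼 x, f x) ^ 2 =
      ∑ S : Finset κ, if S = ∅ then 0 else walshCoeff f S ^ 2 := by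
    rw [← sum_walshCoeff_sq, ← walshCoeff_empty, sub_eq_iff_eq_add,
      ← Finset.sum_erase_add _ _ (Finset.mem_univ (∅ : Finset κ)),
      ← Finset.sum_erase_add _ (fun S : Finset κ => if S = ∅ then 0 else walshCoeff f S ^ 2)
        (Finset.mem_univ (∅ : Finset κ))]
    simp only [if_true, add_zero]
    congr 1
    exact Finset.sum_congr rfl fun S hS => by rw [if_neg (Finset.ne_of_mem_erase hS)]
  rw [hvar]
  -- For nonempty `S`, either `S.card ≤ K` and the noisy weight loses at most `2 ^ K`, or `S.card ≥
  -- K` and the influence weight gains `1 / K`.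
  calc ∑ S : Finset κ, (if S = ∅ then 0 else walshCoeff f S ^ 2)
      ≤ ∑ S : Finset κ, (2 ^ K * (S.card * ((1 / 2 : ℝ) ^ S.card * walshCoeff f S ^ 2)) +
          (1 / K) * (S.card * (1 * walshCoeff f S ^ 2))) := by
        refine Finset.sum_le_sum fun S _ => ?_
        have hw := sq_nonneg (walshCoeff f S)
        split_ifs with hS
        · positivity
        · have hc : (1 : ℝ) ≤ S.card := by
            exact_mod_cast Finset.card_pos.2 (Finset.nonempty_iff_ne_empty.2 hS)
          rcases le_total S.card K with hle | hle
          · have : (1 : ℝ) ≤ 2 ^ K * (S.card * (1 / 2) ^ S.card) := by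
              have h3 : (2 : ℝ) ^ S.card ≤ 2 ^ K := pow_le_pow_right₀ (by norm_num) hle
              have h4 : (2 : ℝ) ^ S.card * (1 / 2) ^ S.card = 1 := by
                rw [← mul_pow]; norm_num
              calc (1 : ℝ) = 2 ^ S.card * (1 * (1 / 2) ^ S.card) := by rw [one_mul, h4]
                _ ≤ _ := by gcongr
            have h5 : 0 ≤ (1 / (K : ℝ)) * (S.card * (1 * walshCoeff f S ^ 2)) := by positivity
            nlinarith
          · have hle' : (K : ℝ) ≤ S.card := by exact_mod_cast hle
            have : 1 ≤ (1 / (K : ℝ)) * S.card := by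
              rw [one_div_mul_eq_div, le_div_iff₀ hKR]; linarith
            have h5 : 0 ≤ 2 ^ K * (S.card * ((1 / 2 : ℝ) ^ S.card * walshCoeff f S ^ 2)) := by
              positivity
            nlinarith
    _ = 2 ^ K * ∑ S : Finset κ, S.card * ((1 / 2 : ℝ) ^ S.card * walshCoeff f S ^ 2) +
          (1 / K) * ∑ S : Finset κ, S.card * (1 * walshCoeff f S ^ 2) := by
        rw [Finset.sum_add_distrib, Finset.mul_sum, Finset.mul_sum]
    _ ≤ 2 ^ K * (Fintype.card κ * (s ^ 2 * q ^ 5)) +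
          (1 / K) * (Fintype.card κ * (s ^ 2 * q ^ 4)) := by gcongr
    _ = _ := by ring

end Cube

/-! ### Deterministic properties of the optimal assignment value. -/

section Assignment

variable {n : ℕ}

/-- The value of the assignment `u` for the cost matrix `y`. -/
noncomputable def assignmentValue (u : Equiv.Perm (Fin n)) (y : Fin n × Fin n → ℝ) : ℝ :=
  assignmentField (fun i j (z : Fin n × Fin n → ℝ) => z (i, j)) u y

/-- The optimal assignment value for the cost matrix `y`. -/
noncomputable def assignmentMax (y : Fin n × Fin n → ℝ) : ℝ :=
  fieldMax (assignmentField (fun i j (z : Fin n × Fin n → ℝ) => z (i, j))) y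

lemma assignmentValue_eq (u : Equiv.Perm (Fin n)) (y : Fin n × Fin n → ℝ) :
    assignmentValue u y = (1 / √(n : ℝ)) * ∑ i, y (i, u i) := rfl

lemma assignmentValue_le_assignmentMax (u : Equiv.Perm (Fin n)) (y : Fin n × Fin n → ℝ) :
    assignmentValue u y ≤ assignmentMax y :=
  Finset.le_sup' (fun v => assignmentValue v y) (Finset.mem_univ u)

lemma exists_assignmentMax_eq (y : Fin n × Fin n → ℝ) :
    ∃ u, assignmentMax y = assignmentValue u y := by
  obtain ⟨u, -, hu⟩ := Finset.exists_mem_eq_sup' Finset.univ_nonempty fun v => assignmentValue v y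
  exact ⟨u, hu⟩

lemma continuous_assignmentMax : Continuous (assignmentMax (n := n)) := by
  refine Continuous.finset_sup'_apply Finset.univ_nonempty fun u _ => ?_
  change Continuous fun y => assignmentValue u y
  simp_rw [assignmentValue_eq]
  fun_prop

/-- Composition with `σ` permutes the assignments. One inequality for every permutation suffices,
since it also applies to `σ⁻¹`. -/
lemma assignmentMax_comp_column (σ : Equiv.Perm (Fin n)) (y : Fin n × Fin n → ℝ) :
    assignmentMax (fun p => y (p.1, σ p.2)) = assignmentMax y := by
  have key : ∀ (τ : Equiv.Perm (Fin n)) (z : Fin n × Fin n → ℝ),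
      assignmentMax (fun p => z (p.1, τ p.2)) ≤ assignmentMax z := by
    intro τ z
    obtain ⟨u, hu⟩ := exists_assignmentMax_eq fun p => z (p.1, τ p.2)
    rw [hu]
    exact assignmentValue_le_assignmentMax (u.trans τ) z
  refine le_antisymm (key σ y) ?_
  simpa using key σ⁻¹ fun p => y (p.1, σ p.2)

lemma assignmentValue_eq_of_ne {u : Equiv.Perm (Fin n)} {i j : Fin n} {y z : Fin n × Fin n → ℝ}
    (hyz : ∀ p, p ≠ (i, j) → y p = z p) (hu : u i ≠ j) :
    assignmentValue u y = assignmentValue u z := by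
  rw [assignmentValue_eq, assignmentValue_eq]
  congr 1
  refine Finset.sum_congr rfl fun a _ => hyz _ fun h => hu ?_
  obtain ⟨rfl, h⟩ := Prod.ext_iff.1 h
  exact h

lemma assignmentValue_eq_add {u : Equiv.Perm (Fin n)} {i j : Fin n} {y z : Fin n × Fin n → ℝ}
    (hyz : ∀ p, p ≠ (i, j) → y p = z p) (hu : u i = j) :
    assignmentValue u y = assignmentValue u z + (1 / √(n : ℝ)) * (y (i, j) - z (i, j)) := by
  rw [assignmentValue_eq, assignmentValue_eq, ← mul_add]
  congr 1
  rw [← Finset.sum_erase_add _ _ (Finset.mem_univ i),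
    ← Finset.sum_erase_add _ (fun a => z (a, u a)) (Finset.mem_univ i), hu,
    Finset.sum_congr rfl fun a ha => hyz (a, u a) fun h =>
      Finset.ne_of_mem_erase ha (Prod.ext_iff.1 h).1]
  ring

/-- The optimal value is nondecreasing in each entry. -/
lemma assignmentMax_le {i j : Fin n} {y z : Fin n × Fin n → ℝ}
    (hyz : ∀ p, p ≠ (i, j) → y p = z p) (hle : z (i, j) ≤ y (i, j)) :
    assignmentMax z ≤ assignmentMax y := by
  obtain ⟨u, hu⟩ := exists_assignmentMax_eq z
  rw [hu]
  refine le_trans ?_ (assignmentValue_le_assignmentMax u y)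
  by_cases h : u i = j
  · rw [assignmentValue_eq_add hyz h]
    have : 0 ≤ (1 / √(n : ℝ)) * (y (i, j) - z (i, j)) :=
      mul_nonneg (by positivity) (sub_nonneg.2 hle)
    linarith
  · rw [assignmentValue_eq_of_ne hyz h]

/-- An assignment optimal for `y` uses the modified entry at most once, and remains a competitor for
`z`. -/
lemma assignmentMax_le_add {i j : Fin n} {y z : Fin n × Fin n → ℝ}
    (hyz : ∀ p, p ≠ (i, j) → y p = z p) (hle : z (i, j) ≤ y (i, j)) :
    assignmentMax y ≤ assignmentMax z + (1 / √(n : ℝ)) * (y (i, j) - z (i, j)) := by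
  obtain ⟨u, hu⟩ := exists_assignmentMax_eq y
  rw [hu]
  have h0 : 0 ≤ (1 / √(n : ℝ)) * (y (i, j) - z (i, j)) :=
    mul_nonneg (by positivity) (sub_nonneg.2 hle)
  have h1 := assignmentValue_le_assignmentMax u z
  by_cases h : u i = j
  · rw [assignmentValue_eq_add hyz h]; linarith
  · rw [assignmentValue_eq_of_ne hyz h]; linarith

/-- If lowering one entry lowers the optimal value, every optimal assignment uses this entry. -/
lemma apply_eq_of_assignmentMax_lt {i j : Fin n} {y z : Fin n × Fin n → ℝ}
    (hyz : ∀ p, p ≠ (i, j) → y p = z p) (hlt : assignmentMax z < assignmentMax y)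
    {u : Equiv.Perm (Fin n)} (hu : assignmentMax y = assignmentValue u y) : u i = j := by
  by_contra h
  rw [hu, assignmentValue_eq_of_ne hyz h] at hlt
  exact hlt.not_ge (assignmentValue_le_assignmentMax u z)

end Assignment

/-! ### Influences and variance of the maximum for sums of signs. -/

section Rademacher

variable {n m : ℕ}

/-- Normalized sums of `m` signs, one for each index. -/
noncomputable def signSum {ι : Type*} (m : ℕ) (x : ι × Fin m → Bool) (p : ι) : ℝ :=
  (√(m : ℝ))⁻¹ * ∑ l, bsign (x (p, l))

lemma signSum_flipAt_of_ne {ι : Type*} [DecidableEq ι] {p p' : ι} (h : p' ≠ p) (l : Fin m)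
    (x : ι × Fin m → Bool) : signSum m (flipAt (p, l) x) p' = signSum m x p' := by
  rw [signSum, signSum]
  congr 1
  refine Finset.sum_congr rfl fun a _ => ?_
  rw [flipAt_of_ne fun e => h (Prod.ext_iff.1 e).1]

lemma signSum_flipAt {ι : Type*} [DecidableEq ι] {p : ι} {l : Fin m}
    {x : ι × Fin m → Bool} (hx : x (p, l) = true) :
    signSum m (flipAt (p, l) x) p = signSum m x p - 2 * (√(m : ℝ))⁻¹ := by
  rw [signSum, signSum, ← Finset.sum_erase_add _ _ (Finset.mem_univ l),
    ← Finset.sum_erase_add _ (fun a => bsign (x (p, a))) (Finset.mem_univ l), flipAt_self, hx,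
    Finset.sum_congr rfl fun a ha => by
      rw [flipAt_of_ne fun e => Finset.ne_of_mem_erase ha (Prod.ext_iff.1 e).2]]
  simp only [bsign, Bool.not_true, Bool.false_eq_true, if_true, if_false]
  ring

/-- The optimal assignment value for matrices of normalized sums of signs. -/
noncomputable def signMax (n m : ℕ) (x : (Fin n × Fin n) × Fin m → Bool) : ℝ :=
  assignmentMax (signSum m x)

lemma signMax_flipAt_bounds {i j : Fin n} {l : Fin m} {x : (Fin n × Fin n) × Fin m → Bool}
    (hx : x ((i, j), l) = true) :
    0 ≤ signMax n m x - signMax n m (flipAt ((i, j), l) x) ∧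
      signMax n m x - signMax n m (flipAt ((i, j), l) x) ≤
        2 * ((√(n : ℝ))⁻¹ * (√(m : ℝ))⁻¹) := by
  have hyz : ∀ p, p ≠ (i, j) → signSum m x p = signSum m (flipAt ((i, j), l) x) p :=
    fun p hp => (signSum_flipAt_of_ne hp l x).symm
  have hd := signSum_flipAt hx
  have h0 : 0 ≤ (√(m : ℝ))⁻¹ := by positivity
  have hle : signSum m (flipAt ((i, j), l) x) (i, j) ≤ signSum m x (i, j) := by linarith
  have h1 := assignmentMax_le hyz hle
  have h2 := assignmentMax_le_add hyz hle
  rw [hd, one_div] at h2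
  constructor
  · simp only [signMax]; linarith
  · simp only [signMax]; linarith

lemma abs_flipDiff_signMax_le (k : (Fin n × Fin n) × Fin m) (x : (Fin n × Fin n) × Fin m → Bool) :
    |flipDiff k (signMax n m) x| ≤ (√(n : ℝ))⁻¹ * (√(m : ℝ))⁻¹ := by
  obtain ⟨⟨i, j⟩, l⟩ := k
  rw [flipDiff, abs_le]
  cases hx : x ((i, j), l)
  · have h := signMax_flipAt_bounds (x := flipAt ((i, j), l) x) (i := i) (j := j) (l := l)
      (by rw [flipAt_self, hx]; rfl)
    rw [flipAt_involutive] at h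
    constructor <;> linarith [h.1, h.2]
  · have h := signMax_flipAt_bounds hx
    constructor <;> linarith [h.1, h.2]

/-- The indicator that the `k`-th sign is positive and pivotal for the optimal value. -/
noncomputable def posPivotal (k : (Fin n × Fin n) × Fin m) (x : (Fin n × Fin n) × Fin m → Bool) :
    ℝ :=
  if x k = true ∧ signMax n m x ≠ signMax n m (flipAt k x) then 1 else 0

/-- Being pivotal is invariant under the flip, and exactly one of `x` and `flipAt k x` has a
positive `k`-th sign; hence the factor `2`. -/
lemma expect_flipDiff_ne_zero (k : (Fin n × Fin n) × Fin m) :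
    (𝔼 x, if flipDiff k (signMax n m) x = 0 then (0 : ℝ) else 1) = 2 * 𝔼 x, posPivotal k x := by
  have h : ∀ x, (if flipDiff k (signMax n m) x = 0 then (0 : ℝ) else 1) =
      posPivotal k x + posPivotal k (flipAt k x) := by
    intro x
    simp only [flipDiff, posPivotal, flipAt_self, flipAt_involutive k x, div_eq_zero_iff,
      OfNat.ofNat_ne_zero, or_false, sub_eq_zero]
    by_cases h : signMax n m x = signMax n m (flipAt k x)
    · simp [h]
    · cases x k <;> simp [h, Ne.symm h]
  simp_rw [h, Finset.expect_add_distrib, expect_flipAt]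
  ring

/-- Flipping a positive pivotal sign lowers the optimum, so a fixed optimal `u` must use that entry:
only `j = u i` contributes. -/
lemma sum_posPivotal_le_one (i : Fin n) (l : Fin m) (x : (Fin n × Fin n) × Fin m → Bool) :
    ∑ j, posPivotal ((i, j), l) x ≤ 1 := by
  obtain ⟨u, hu⟩ := exists_assignmentMax_eq (signSum m x)
  calc ∑ j, posPivotal ((i, j), l) x ≤ ∑ j, if u i = j then (1 : ℝ) else 0 := by
        refine Finset.sum_le_sum fun j _ => ?_
        rw [posPivotal]
        split_ifs with h1 h2 h2
        · exact le_rfl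
        · refine absurd (apply_eq_of_assignmentMax_lt
            (fun p hp => (signSum_flipAt_of_ne hp l x).symm) ?_ hu) h2
          exact lt_of_le_of_ne (sub_nonneg.1 (signMax_flipAt_bounds h1.1).1) h1.2.symm
        · exact zero_le_one
        · exact le_rfl
    _ = 1 := by simp

lemma flipAt_comp_equiv {κ : Type*} [DecidableEq κ] (e : κ ≃ κ) (k : κ) (x : κ → Bool) :
    flipAt k (x ∘ e) = flipAt (e k) x ∘ e := by
  ext i
  by_cases h : i = k
  · subst h; simp [flipAt_self]
  · rw [flipAt_of_ne h, Function.comp_apply, Function.comp_apply,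
      flipAt_of_ne (e.injective.ne h)]

/-- Swapping columns `j` and `j'` preserves the uniform measure and the maximum. -/
lemma expect_posPivotal_eq (i j j' : Fin n) (l : Fin m) :
    𝔼 x, posPivotal ((i, j), l) x = 𝔼 x, posPivotal ((i, j'), l) x := by
  let σ : Equiv.Perm (Fin n) := Equiv.swap j j'
  let e : (Fin n × Fin n) × Fin m ≃ (Fin n × Fin n) × Fin m :=
    Equiv.prodCongr (Equiv.prodCongr (Equiv.refl _) σ) (Equiv.refl _)
  have he : e ((i, j), l) = ((i, j'), l) := by simp [e, σ]
  have hinv : ∀ x, signMax n m (x ∘ e) = signMax n m x := fun x =>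
    assignmentMax_comp_column σ (signSum m x)
  refine (Fintype.expect_equiv (Equiv.arrowCongr e.symm (Equiv.refl Bool)) _ _ fun x => ?_).symm
  have : (Equiv.arrowCongr e.symm (Equiv.refl Bool)) x = x ∘ e := by ext; simp
  rw [this]
  simp only [posPivotal, flipAt_comp_equiv, hinv, Function.comp_apply, he]

lemma expect_posPivotal_le (k : (Fin n × Fin n) × Fin m) : 𝔼 x, posPivotal k x ≤ 1 / n := by
  obtain ⟨⟨i, j⟩, l⟩ := k
  have hn : (0 : ℝ) < n := by exact_mod_cast i.pos
  have h1 : ∑ j', 𝔼 x, posPivotal (m := m) ((i, j'), l) x ≤ 1 := by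
    rw [← Finset.expect_sum_comm]
    exact Finset.expect_le Finset.univ_nonempty fun x _ => sum_posPivotal_le_one i l x
  rw [Finset.sum_congr rfl fun j' _ => expect_posPivotal_eq i j' j l] at h1
  rw [le_div_iff₀ hn]
  simpa [mul_comm] using h1

lemma expect_signMax_sq_sub_le (hn : 0 < n) (hm : 0 < m) {K : ℕ} (hK : 0 < K) :
    𝔼 x, signMax n m x ^ 2 - (𝔼 x, signMax n m x) ^ 2 ≤
      n * (2 ^ K * √√(2 / n) ^ 5 + √√(2 / n) ^ 4 / K) := by
  have hnR : (0 : ℝ) < n := by exact_mod_cast hn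
  have hmR : (0 : ℝ) < m := by exact_mod_cast hm
  -- `q` is the fourth root of the pivotality bound `2 / n`. The prefactor is `n ^ 2 * m`
  -- coordinates times `s ^ 2 = 1 / (n * m)`, so `m` cancels.
  have hq : √√(2 / (n : ℝ)) ^ 4 = 2 / n := by
    rw [show 4 = 2 * 2 from rfl, pow_mul, Real.sq_sqrt (by positivity), Real.sq_sqrt (by positivity)]
  refine (expect_sq_sub_sq_expect_le (q := √√(2 / (n : ℝ))) (by positivity)
    abs_flipDiff_signMax_le (fun k => ?_) hK).trans_eq ?_
  · rw [expect_flipDiff_ne_zero, hq]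
    have := expect_posPivotal_le k
    calc _ ≤ 2 * (1 / (n : ℝ)) := by gcongr
      _ = _ := by ring
  · congr 1
    rw [mul_pow, inv_pow, inv_pow, Real.sq_sqrt hnR.le, Real.sq_sqrt hmR.le]
    simp
    field_simp

end Rademacher

/-! ### Passage from sums of signs to Gaussian vectors. -/

section CentralLimit

lemma integral_uniformOn_univ {Ω E : Type*} [Fintype Ω] [Nonempty Ω] [MeasurableSpace Ω]
    [MeasurableSingletonClass Ω] [NormedAddCommGroup E] [NormedSpace ℝ E] [CompleteSpace E]
    (F : Ω → E) :
    ∫ x, F x ∂(uniformOn (Set.univ : Set Ω)) = (Fintype.card Ω : ℝ)⁻¹ • ∑ x, F x := by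
  have := isProbabilityMeasure_uniformOn (Set.finite_univ (α := Ω)) Set.univ_nonempty
  rw [integral_fintype .of_finite, Finset.smul_sum]
  refine Finset.sum_congr rfl fun x _ => ?_
  rw [measureReal_def, uniformOn_univ]
  simp

instance isProbabilityMeasure_uniformOn_univ {Ω : Type*} [Finite Ω] [Nonempty Ω]
    [MeasurableSpace Ω] [MeasurableSingletonClass Ω] :
    IsProbabilityMeasure (uniformOn (Set.univ : Set Ω)) :=
  isProbabilityMeasure_uniformOn Set.finite_univ Set.univ_nonempty

variable {ι : Type*} [Fintype ι] [DecidableEq ι]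

/-- The law of the matrix of normalized sums of `m` signs. -/
noncomputable def signSumLaw (ι : Type*) [Fintype ι] (m : ℕ) :
    ProbabilityMeasure (EuclideanSpace ℝ ι) :=
  ⟨(uniformOn (Set.univ : Set (ι × Fin m → Bool))).map fun x => WithLp.toLp 2 (signSum m x),
    Measure.isProbabilityMeasure_map (measurable_of_finite _).aemeasurable⟩

/-- The law of a vector of independent standard Gaussian variables. -/
noncomputable def gaussianPi (ι : Type*) [Fintype ι] : ProbabilityMeasure (EuclideanSpace ℝ ι) :=
  ⟨(Measure.pi fun _ : ι => gaussianReal 0 1).map (WithLp.toLp 2),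
    Measure.isProbabilityMeasure_map (by fun_prop)⟩

lemma integral_signSumLaw {E : Type*} [NormedAddCommGroup E] [NormedSpace ℝ E] [CompleteSpace E]
    (m : ℕ) {G : EuclideanSpace ℝ ι → E} (hG : Continuous G) :
    ∫ y, G y ∂(signSumLaw ι m : Measure (EuclideanSpace ℝ ι)) =
      (Fintype.card (ι × Fin m → Bool) : ℝ)⁻¹ • ∑ x, G (WithLp.toLp 2 (signSum m x)) := by
  rw [signSumLaw, ProbabilityMeasure.coe_mk,
    integral_map_of_stronglyMeasurable (measurable_of_finite _) ?_, integral_uniformOn_univ]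
  exact hG.stronglyMeasurable

lemma charFun_map_bsign (s : ℝ) :
    charFun ((uniformOn (Set.univ : Set Bool)).map bsign) s =
      2⁻¹ * ∑ b, Complex.exp (s * bsign b * Complex.I) := by
  rw [charFun_apply_real, integral_map (measurable_of_finite _).aemeasurable
    (by fun_prop), integral_uniformOn_univ]
  simp [mul_add]

lemma charFun_signSumLaw (m : ℕ) (t : EuclideanSpace ℝ ι) :
    charFun (signSumLaw ι m : Measure (EuclideanSpace ℝ ι)) t =
      ∏ p, charFun ((uniformOn (Set.univ : Set Bool)).map bsign) ((√(m : ℝ))⁻¹ * t p) ^ m := by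
  rw [charFun_apply, integral_signSumLaw m (by fun_prop)]
  have h1 : ∀ x : ι × Fin m → Bool,
      Complex.exp (inner ℝ (WithLp.toLp 2 (signSum m x)) t * Complex.I) =
        ∏ k : ι × Fin m,
          Complex.exp (((√(m : ℝ))⁻¹ * t k.1 : ℝ) * bsign (x k) * Complex.I) := by
    intro x
    rw [← Complex.exp_sum, Fintype.sum_prod_type, PiLp.inner_apply]
    congr 1
    rw [Complex.ofReal_sum, Finset.sum_mul]
    refine Finset.sum_congr rfl fun p _ => ?_
    simp only [signSum, RCLike.inner_apply, conj_trivial]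
    push_cast
    rw [Finset.mul_sum, Finset.mul_sum, Finset.sum_mul]
    exact Finset.sum_congr rfl fun l _ => by ring
  simp_rw [h1, charFun_map_bsign]
  -- Independence of the signs: the sum over the cube of a product over coordinates is a product of
  -- two-term sums.
  have h2 := Finset.prod_univ_sum (fun _ : ι × Fin m => (Finset.univ : Finset Bool))
    fun k b => Complex.exp (((√(m : ℝ))⁻¹ * t k.1 : ℝ) * bsign b * Complex.I)
  rw [Fintype.piFinset_univ] at h2
  rw [← h2, Fintype.prod_prod_type]
  simp only [Finset.prod_const, Finset.card_univ, Fintype.card_fin, mul_pow]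
  rw [Finset.prod_mul_distrib]
  simp only [Finset.prod_const, Finset.card_univ, Fintype.card_pi, Fintype.card_bool,
    Fintype.card_prod, Fintype.card_fin]
  rw [Complex.real_smul]
  push_cast
  rw [inv_pow, inv_pow, ← pow_mul, mul_comm m]

/-- The central limit theorem for vectors of independent sums of signs. -/
lemma tendsto_signSumLaw : Tendsto (signSumLaw ι) atTop (𝓝 (gaussianPi ι)) := by
  refine ProbabilityMeasure.tendsto_of_tendsto_charFun fun t => ?_
  simp_rw [charFun_signSumLaw]
  rw [gaussianPi, ProbabilityMeasure.coe_mk, charFun_pi]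
  refine tendsto_finsetProd _ fun p _ => ?_
  have := tendsto_charFun_inv_sqrt_mul_pow (P := uniformOn (Set.univ : Set Bool)) (X := bsign)
    (measurable_of_finite _).aemeasurable (by rw [integral_uniformOn_univ]; simp [bsign])
    (by rw [integral_uniformOn_univ]; simp [bsign]) (t p)
  simpa [charFun_gaussianReal, neg_div] using this

lemma tendsto_expect_signSum {G : (ι → ℝ) → ℝ} (hG : Continuous G) {C : ℝ}
    (hC : ∀ y, |G y| ≤ C) :
    Tendsto (fun m => 𝔼 x : ι × Fin m → Bool, G (signSum m x)) atTop
      (𝓝 (∫ y, G y ∂Measure.pi fun _ : ι => gaussianReal 0 1)) := by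
  have hG' : Continuous fun y : EuclideanSpace ℝ ι => G (WithLp.ofLp y) := by fun_prop
  let g : BoundedContinuousFunction (EuclideanSpace ℝ ι) ℝ :=
    BoundedContinuousFunction.ofNormedAddCommGroup (fun y => G (WithLp.ofLp y)) hG' C
      fun y => hC _
  have h := ProbabilityMeasure.tendsto_iff_forall_integral_tendsto.1
    (tendsto_signSumLaw (ι := ι)) g
  have e1 : ∀ m, ∫ y, g y ∂(signSumLaw ι m : Measure (EuclideanSpace ℝ ι)) =
      𝔼 x : ι × Fin m → Bool, G (signSum m x) := by
    intro m
    rw [integral_signSumLaw m g.continuous, Fintype.expect_eq_sum_div_card, smul_eq_mul,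
      div_eq_inv_mul]
    rfl
  have e2 : ∫ y, g y ∂(gaussianPi ι : Measure (EuclideanSpace ℝ ι)) =
      ∫ y, G y ∂Measure.pi fun _ : ι => gaussianReal 0 1 := by
    rw [gaussianPi, ProbabilityMeasure.coe_mk,
      integral_map (by fun_prop) g.continuous.aestronglyMeasurable]
    rfl
  rw [e2] at h
  exact h.congr e1

/-- Clamping is 1-Lipschitz, and the mean square deviation from any centre, here the clamped mean of
`f`, is at least the variance. -/
lemma expect_sq_sub_sq_expect_clamp_le {Ω : Type*} [Fintype Ω] [Nonempty Ω] (f : Ω → ℝ) (R : ℝ) :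
    𝔼 x, (max (-R) (min (f x) R)) ^ 2 - (𝔼 x, max (-R) (min (f x) R)) ^ 2 ≤
      𝔼 x, f x ^ 2 - (𝔼 x, f x) ^ 2 := by
  have key : ∀ (g : Ω → ℝ) (a : ℝ),
      𝔼 x, (g x - a) ^ 2 = 𝔼 x, g x ^ 2 - (𝔼 x, g x) ^ 2 + (𝔼 x, g x - a) ^ 2 := by
    intro g a
    have : ∀ x, (g x - a) ^ 2 = g x ^ 2 - (2 * a) * g x + a ^ 2 := fun x => by ring
    simp_rw [this, Finset.expect_add_distrib, Finset.expect_sub_distrib, ← Finset.mul_expect,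
      Fintype.expect_const]
    ring
  set a := 𝔼 x, f x with ha
  have h1 := key (fun x => max (-R) (min (f x) R)) (max (-R) (min a R))
  have h2 := key f a
  rw [← ha, sub_self] at h2
  have h3 : 𝔼 x, (max (-R) (min (f x) R) - max (-R) (min a R)) ^ 2 ≤ 𝔼 x, (f x - a) ^ 2 := by
    refine Finset.expect_le_expect fun x _ => sq_le_sq.2 ?_
    calc |max (-R) (min (f x) R) - max (-R) (min a R)|
        = |max (min (f x) R) (-R) - max (min a R) (-R)| := by rw [max_comm, max_comm (-R)]
      _ ≤ |min (f x) R - min a R| := abs_max_sub_max_le_abs _ _ _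
      _ ≤ |f x - a| := by
        have := abs_min_sub_min_le_max (f x) R a R
        simpa using this
  nlinarith [sq_nonneg (𝔼 x, max (-R) (min (f x) R) - max (-R) (min a R))]

/-- Variance bounds for vectors of sums of signs pass to the Gaussian limit. -/
lemma variance_pi_gaussianReal_le {F : (ι → ℝ) → ℝ} (hF : Continuous F)
    (hF2 : MemLp F 2 (Measure.pi fun _ : ι => gaussianReal 0 1)) {C : ℝ}
    (hC : ∀ m, 0 < m → 𝔼 x : ι × Fin m → Bool, F (signSum m x) ^ 2 -
      (𝔼 x : ι × Fin m → Bool, F (signSum m x)) ^ 2 ≤ C) :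
    Var[F; Measure.pi fun _ : ι => gaussianReal 0 1] ≤ C := by
  set γ := Measure.pi fun _ : ι => gaussianReal 0 1
  -- Weak convergence only tests bounded continuous functions, so `F` is clamped at height `R`;
  -- dominated convergence removes the clamp afterwards.
  set H : ℕ → (ι → ℝ) → ℝ := fun R y => max (-(R : ℝ)) (min (F y) R) with hH
  have hHc : ∀ R, Continuous (H R) := fun R => by fun_prop
  have hHR : ∀ R y, |H R y| ≤ R := fun R y =>
    abs_le.2 ⟨le_max_left _ _, max_le (by linarith [Nat.cast_nonneg (α := ℝ) R]) (min_le_right _ _)⟩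
  have hHF : ∀ R y, |H R y| ≤ |F y| := by
    intro R y
    have hR := Nat.cast_nonneg (α := ℝ) R
    refine abs_le.2 ⟨?_, max_le ((neg_nonpos.2 hR).trans (abs_nonneg _))
      ((min_le_left _ _).trans (le_abs_self _))⟩
    refine le_max_of_le_right (le_min (neg_abs_le _) ((neg_nonpos.2 (abs_nonneg _)).trans hR))
  have htrunc : ∀ R, ∫ y, H R y ^ 2 ∂γ - (∫ y, H R y ∂γ) ^ 2 ≤ C := by
    intro R
    have l1 := tendsto_expect_signSum (hHc R) (hHR R)
    have l2 := tendsto_expect_signSum (G := fun y => H R y ^ 2) (C := (R : ℝ) ^ 2)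
      (by fun_prop) fun y => by
        rw [abs_pow]; exact pow_le_pow_left₀ (abs_nonneg _) (hHR R y) 2
    refine le_of_tendsto (l2.sub (l1.pow 2)) ?_
    filter_upwards [eventually_gt_atTop 0] with m hm
    exact (expect_sq_sub_sq_expect_clamp_le _ _).trans (hC m hm)
  have hlim : ∀ y, Tendsto (fun R => H R y) atTop (𝓝 (F y)) := by
    intro y
    refine tendsto_const_nhds.congr' ?_
    obtain ⟨N, hN⟩ := exists_nat_ge |F y|
    filter_upwards [eventually_ge_atTop N] with R hR
    have hR' : |F y| ≤ R := hN.trans (by exact_mod_cast hR)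
    rw [hH]
    simp only
    rw [min_eq_left (abs_le.1 hR').2, max_eq_right (abs_le.1 hR').1]
  have t1 : Tendsto (fun R => ∫ y, H R y ∂γ) atTop (𝓝 (∫ y, F y ∂γ)) :=
    tendsto_integral_of_dominated_convergence (fun y => |F y|)
      (fun R => (hHc R).aestronglyMeasurable) (hF2.integrable one_le_two).abs
      (fun R => ae_of_all _ fun y => hHF R y) (ae_of_all _ hlim)
  have t2 : Tendsto (fun R => ∫ y, H R y ^ 2 ∂γ) atTop (𝓝 (∫ y, F y ^ 2 ∂γ)) :=
    tendsto_integral_of_dominated_convergence (fun y => F y ^ 2)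
      (fun R => ((hHc R).pow 2).aestronglyMeasurable) hF2.integrable_sq
      (fun R => ae_of_all _ fun y => by
        rw [Real.norm_eq_abs, abs_pow, ← sq_abs (F y)]
        exact pow_le_pow_left₀ (abs_nonneg _) (hHF R y) 2)
      (ae_of_all _ fun y => (hlim y).pow 2)
  rw [variance_eq_sub hF2]
  exact le_of_tendsto (t2.sub (t1.pow 2)) (Eventually.of_forall htrunc)

end CentralLimit

/-! ### Integrability and variance for Gaussian matrices. -/

section GaussianAssignment

variable {n : ℕ}

lemma abs_assignmentValue_le (u : Equiv.Perm (Fin n)) (y : Fin n × Fin n → ℝ) :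
    |assignmentValue u y| ≤ (1 / √(n : ℝ)) * ∑ p, |y p| := by
  rw [assignmentValue_eq, abs_mul, abs_of_nonneg (by positivity : 0 ≤ 1 / √(n : ℝ)),
    Fintype.sum_prod_type]
  gcongr
  refine (Finset.abs_sum_le_sum_abs _ _).trans (Finset.sum_le_sum fun i _ => ?_)
  exact Finset.single_le_sum (f := fun j => |y (i, j)|) (fun _ _ => abs_nonneg _)
    (Finset.mem_univ (u i))

lemma memLp_assignmentMax :
    MemLp (assignmentMax (n := n)) 2 (Measure.pi fun _ => gaussianReal 0 1) := by
  have hcoord : ∀ p : Fin n × Fin n, MemLp (fun y : Fin n × Fin n → ℝ => |y p|) 2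
      (Measure.pi fun _ => gaussianReal 0 1) := fun p =>
    (IsGaussian.memLp_two_id.comp_measurePreserving
      (measurePreserving_eval (fun _ : Fin n × Fin n => gaussianReal 0 1) p)).abs
  refine ((memLp_finsetSum Finset.univ fun p _ => hcoord p).const_mul (1 / √(n : ℝ))).mono
    continuous_assignmentMax.aestronglyMeasurable (ae_of_all _ fun y => ?_)
  obtain ⟨u, hu⟩ := exists_assignmentMax_eq y
  rw [hu, Real.norm_eq_abs]
  exact (abs_assignmentValue_le u y).trans (le_abs_self _)

lemma variance_assignmentMax_le (hn : 0 < n) {K : ℕ} (hK : 0 < K) :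
    Var[assignmentMax (n := n); Measure.pi fun _ => gaussianReal 0 1] ≤
      2 ^ (K + 1) * √√(2 / n) + 2 / K := by
  have hnR : (0 : ℝ) < n := by exact_mod_cast hn
  have hq : √√(2 / (n : ℝ)) ^ 4 = 2 / n := by
    rw [show 4 = 2 * 2 from rfl, pow_mul, Real.sq_sqrt (by positivity), Real.sq_sqrt (by positivity)]
  refine (variance_pi_gaussianReal_le continuous_assignmentMax memLp_assignmentMax
    fun m hm => expect_signMax_sq_sub_le hn hm hK).trans_eq ?_
  -- With `q ^ 4 = 2 / n`, the terms `n * q ^ 5` and `n * q ^ 4` become `2 * q` and `2`.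
  rw [pow_succ _ 4, hq]
  field_simp
  ring

lemma tendsto_variance_assignmentMax :
    Tendsto (fun n : ℕ => Var[assignmentMax (n := n); Measure.pi fun _ => gaussianReal 0 1])
      atTop (𝓝 0) := by
  refine tendsto_order.2 ⟨fun a ha => Eventually.of_forall fun n => ha.trans_le
    (variance_nonneg _ _), fun ε hε => ?_⟩
  -- `K` is fixed first, making `2 / K < ε / 2`; only then is `n` taken large enough to absorb `2 ^
  -- (K + 1)`.
  obtain ⟨K, hK⟩ := exists_nat_gt (4 / ε)
  have hKR : (0 : ℝ) < K := lt_trans (by positivity) hK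
  have hK2 : 2 / (K : ℝ) < ε / 2 := by
    rw [div_lt_iff₀ hε] at hK
    rw [div_lt_iff₀ hKR]
    linarith
  have hlim : Tendsto (fun n : ℕ => 2 ^ (K + 1) * √√(2 / (n : ℝ))) atTop (𝓝 0) := by
    have h := ((tendsto_const_div_atTop_nhds_zero_nat (2 : ℝ)).sqrt.sqrt).const_mul
      ((2 : ℝ) ^ (K + 1))
    simpa using h
  filter_upwards [hlim.eventually_lt_const (half_pos hε), eventually_gt_atTop 0] with n h1 hn
  have := variance_assignmentMax_le hn (K := K) (by exact_mod_cast hKR)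
  linarith

lemma variance_assignmentField {Ω : Type*} [MeasurableSpace Ω] {μ : Measure Ω}
    {c : Fin n → Fin n → Ω → ℝ} (hn : 0 < n)
    (hlaw : ∀ i j, HasLaw (c i j) (gaussianReal 0 1) μ)
    (hindep : iIndepFun (fun p : Fin n × Fin n => c p.1 p.2) μ) (u : Equiv.Perm (Fin n)) :
    Var[assignmentField c u; μ] = 1 := by
  have hnR : (0 : ℝ) < n := by exact_mod_cast hn
  have hsum : Var[∑ i, c i (u i); μ] = n := by
    rw [IndepFun.variance_sum]
    · simp [fun i => (hlaw i (u i)).variance_eq]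
    · intro i _
      have h := IsGaussian.memLp_two_id (μ := gaussianReal 0 1)
      rw [← (hlaw i (u i)).map_eq] at h
      simpa using (memLp_map_measure_iff aestronglyMeasurable_id (hlaw i (u i)).aemeasurable).1 h
    · intro i _ j _ hij
      exact hindep.indepFun (i := (i, u i)) (j := (j, u j)) fun h => hij (Prod.ext_iff.1 h).1
  have : assignmentField c u = fun ω => (1 / √(n : ℝ)) * (∑ i, c i (u i)) ω := by
    ext ω
    rw [assignmentField, Finset.sum_apply]
  rw [this, variance_const_mul, hsum, div_pow, Real.sq_sqrt hnR.le]
  field_simp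

end GaussianAssignment

theorem corollary1 {Ω : ℕ → Type*} [∀ n, MeasurableSpace (Ω n)]
    (μ : ∀ n, Measure (Ω n)) [∀ n, IsProbabilityMeasure (μ n)]
    (c : ∀ n, Fin n → Fin n → Ω n → ℝ)
    (hlaw : ∀ n i j, HasLaw (c n i j) (gaussianReal 0 1) (μ n))
    (hindep : ∀ n, iIndepFun (fun p : Fin n × Fin n => c n p.1 p.2) (μ n)) :
    (∀ n, MemLp (fieldMax (assignmentField (c n))) 2 (μ n)) ∧
      Tendsto (fun n => Var[fieldMax (assignmentField (c n)); μ n]) atTop (𝓝 0) ∧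
      IsSuperconcentrated μ (fun n => assignmentField (c n)) := by
  have hX : ∀ n, HasLaw (fun ω (p : Fin n × Fin n) => c n p.1 p.2 ω)
      (Measure.pi fun _ => gaussianReal 0 1) (μ n) := fun n =>
    (hindep n).hasLaw_pi fun p => hlaw n p.1 p.2
  have hmax : ∀ n, fieldMax (assignmentField (c n)) =
      assignmentMax ∘ fun ω (p : Fin n × Fin n) => c n p.1 p.2 ω := fun n => rfl
  have hmem : ∀ n, MemLp (fieldMax (assignmentField (c n))) 2 (μ n) := by
    intro n
    have h := memLp_assignmentMax (n := n)
    rw [← (hX n).map_eq] at h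
    rw [hmax]
    exact (memLp_map_measure_iff continuous_assignmentMax.aestronglyMeasurable
      (hX n).aemeasurable).1 h
  have hvar : ∀ n, Var[fieldMax (assignmentField (c n)); μ n] =
      Var[assignmentMax (n := n); Measure.pi fun _ => gaussianReal 0 1] := by
    intro n
    rw [← (hX n).map_eq, variance_map continuous_assignmentMax.aemeasurable (hX n).aemeasurable]
    rfl
  have hlim : Tendsto (fun n => Var[fieldMax (assignmentField (c n)); μ n]) atTop (𝓝 0) := by
    simp_rw [hvar]
    exact tendsto_variance_assignmentMax
  refine ⟨hmem, hlim, ?_⟩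
  -- The equality holds only eventually: for `n = 0` the field is identically zero and has variance
  -- `0`.
  have hone : (fun n => fieldMaxVariance (μ n) (assignmentField (c n))) =ᶠ[atTop]
      fun _ => (1 : ℝ) := by
    filter_upwards [eventually_gt_atTop 0] with n hn
    simp_rw [fieldMaxVariance, variance_assignmentField hn (hlaw n) (hindep n)]
    exact Finset.sup'_const _ _
  exact ((isLittleO_one_iff ℝ).2 hlim).congr' EventuallyEq.rfl hone.symm
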